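/- \textbf{Theorem (Optimal Unpredictability Hardcore Lemma).} A Boolean circuit on $n$ input bits is a directed acyclic graph whose vertices are input bits, constants, or arbitrary Boolean gates of fan-in two, one vertex being the output; its size is its number of vertices. There is an absolute constant $c>0$ such that the following holds. Let $n\in\mathbb{N}$, let $V$ be a probability distribution on $\{0,1\}^n$, let $f:\{0,1\}^n\to\{0,1\}$, let $s\in\mathbb{N}$ and $\epsilon\in(0,1]$, and suppose that $f$ is $\epsilon$-unpredictable under $V$ by circuits of size $s$, that is, $$\Pr_{x\leftarrow V}[A(x)=f(x)]\le 1-\frac{\epsilon}{2}\qquad\text{for every circuit } A \text{ of size at most } s.$$ Then for every $\delta\in(0,1)$ there is an event $E$ of probability exactly $\epsilon$ (on a probability space carrying a random variable $x$ with distribution $V$; $E$ need not be determined by $x$) such that $$\Pr_{x\leftarrow V|E}[A(x)=f(x)]\le\frac{1+\delta}{2}\qquad\text{for every circuit } A \text{ of size at most } s'=c\cdot\frac{s\,\delta^{2}}{\log(2/\epsilon)},$$ where $V|E$ denotes the distribution of $x$ conditioned on $E$. (For $\epsilon\le\frac12$ one has $\log(2/\epsilon)\le 2\log(1/\epsilon)$,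 so this is $s'=\Omega(s\delta^2/\log(1/\epsilon))$.) -/

import Mathlib

open MeasureTheory ProbabilityTheory

/-- A vertex of a Boolean circuit on `n` input bits, at a position preceded by `k` other vertices:
an input bit, a constant, or a gate of fan-in two (of arbitrary Boolean type) that reads two earlier
vertices. The two vertices read by a gate may coincide, so negation is a gate too. -/
inductive CircuitNode (n k : ℕ) : Type where
  | input (i : Fin n) : CircuitNode n k
  | const (b : Bool) : CircuitNode n k
  | gate (op : Bool → Bool → Bool) (i j : Fin k) : CircuitNode n k

/-- The value of a vertex on the input `x`, given the values `w` of the `k` earlier vertices. -/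
def CircuitNode.value {n k : ℕ} (x : Fin n → Bool) (w : Fin k → Bool) : CircuitNode n k → Bool
  | .input i => x i
  | .const b => b
  | .gate op i j => op (w i) (w j)

/-- A Boolean circuit with `k` vertices, listed in a topological order; the value of a vertex may be
used by any number of later vertices. -/
inductive CircuitGraph (n : ℕ) : ℕ → Type where
  | nil : CircuitGraph n 0
  | snoc {k : ℕ} (P : CircuitGraph n k) (v : CircuitNode n k) : CircuitGraph n (k + 1)

/-- The values of all vertices on the input `x`. -/
def CircuitGraph.values {n : ℕ} (x : Fin n → Bool) :
    {k : ℕ} → CircuitGraph n k → (Fin k → Bool)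
  | _, .nil => Fin.elim0
  | _, .snoc P v => Fin.snoc (α := fun _ => Bool) (P.values x) (v.value x (P.values x))

/-- A Boolean circuit on `n` input bits with one output bit, the value of the last vertex. In
particular it has at least one vertex. -/
structure BoolCircuit (n : ℕ) where
  pred : ℕ
  graph : CircuitGraph n (pred + 1)

/-- The size of a circuit: its number of vertices. -/
def BoolCircuit.size {n : ℕ} (A : BoolCircuit n) : ℕ := A.pred + 1

/-- The Boolean function computed by a circuit. -/
def BoolCircuit.eval {n : ℕ} (A : BoolCircuit n) (x : Fin n → Bool) : Bool :=
  A.graph.values x (Fin.last A.pred)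

/-!
Suppose that every density of mass `ε` lets some small circuit agree with `f` with advantage `δ`.
Boosting then combines small circuits into a threshold circuit that errs with probability less than
`ε / 2`. After some rounds let `F x` be `-δ / 2` times the number of correct votes on `x` minus the
number of wrong ones. The weights `min 1 (exp (F x - r))` have mass `ε` for exactly those `r` that
minimize the convex potential `ε r + ∫ ψ (F - r)`, `ψ` the primitive of `min 1 exp`; as they are
capped, they form a density, and a circuit with advantage `δ` on it decreases the potential by
`ε δ² / 4`. The initial potential is `ε (1 - log ε)`, so it is negative after
`O(log (2 / ε) / δ²)` rounds. Since `ψ u ≥ max u 0`, this bounds the average margin deficit by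
`ε θ` for some margin `θ > 0`, and a threshold drawn uniformly from `[-θ, θ]` errs with probability
less than `ε / 2` on average.

Thresholds of `t` bits have circuits of size `O(t)`: full adders halve the number of bits to be
added, one binary digit at a time. So the combined circuit is larger than its parts by a factor
`O(log (2 / ε) / δ²)` only, and unpredictability rules it out. Some density `h` of mass `ε` is
therefore hard for small circuits, and the region below its graph in `{0,1}ⁿ × [0,1]` is the event.
-/

namespace CircuitGraph

variable {n k l : ℕ}

theorem values_snoc_castSucc (P : CircuitGraph n k) (v : CircuitNode n k) (x : Fin n → Bool)
    (i : Fin k) : (P.snoc v).values x i.castSucc = P.values x i := by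
  simp [values]

theorem values_snoc_last (P : CircuitGraph n k) (v : CircuitNode n k) (x : Fin n → Bool) :
    (P.snoc v).values x (Fin.last k) = v.value x (P.values x) := by
  simp [values]

theorem exists_append (P : CircuitGraph n k) (Q : CircuitGraph n l) :
    ∃ R : CircuitGraph n (k + l), (∀ x i, R.values x (Fin.castAdd l i) = P.values x i) ∧
      ∀ x j, R.values x (Fin.natAdd k j) = Q.values x j := by
  induction Q with
  | nil => exact ⟨P, fun _ _ => rfl, fun _ j => j.elim0⟩
  | @snoc l Q v ih =>
    obtain ⟨R, hP, hQ⟩ := ih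
    obtain ⟨w, hw⟩ : ∃ w : CircuitNode n (k + l),
        ∀ x, w.value x (R.values x) = v.value x (Q.values x) := by
      cases v with
      | input i => exact ⟨.input i, fun _ => rfl⟩
      | const b => exact ⟨.const b, fun _ => rfl⟩
      | gate op i j =>
        exact ⟨.gate op (Fin.natAdd k i) (Fin.natAdd k j), fun x => by
          simp only [CircuitNode.value, hQ]⟩
    refine ⟨R.snoc w, fun x i => ?_, fun x j => ?_⟩
    · exact (values_snoc_castSucc R w x (Fin.castAdd l i)).trans (hP x i)
    · induction j using Fin.lastCases with
      | last => rw [values_snoc_last, ← hw x]; exact values_snoc_last R w x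
      | cast j =>
        rw [values_snoc_castSucc, ← hQ x j]
        exact values_snoc_castSucc R w x (Fin.natAdd k j)

/-- Some vertex of the circuit graph `P`, not necessarily the last one, computes `g`. -/
def Computes (P : CircuitGraph n k) (g : (Fin n → Bool) → Bool) : Prop :=
  ∃ i, ∀ x, P.values x i = g x

theorem Computes.snoc {P : CircuitGraph n k} {g : (Fin n → Bool) → Bool} (h : P.Computes g)
    (v : CircuitNode n k) : (P.snoc v).Computes g := by
  obtain ⟨i, hi⟩ := h
  exact ⟨i.castSucc, fun x => (P.values_snoc_castSucc v x i).trans (hi x)⟩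

theorem computes_snoc_value (P : CircuitGraph n k) (v : CircuitNode n k) :
    (P.snoc v).Computes fun x => v.value x (P.values x) :=
  ⟨Fin.last k, P.values_snoc_last v⟩

end CircuitGraph

/-- The functions in `S` are all computed by vertices of one circuit graph with at most `k`
vertices. Gates can thus be shared, as they have to be in circuits of linear size. -/
def JointlyComputable (n k : ℕ) (S : Set ((Fin n → Bool) → Bool)) : Prop :=
  ∃ l ≤ k, ∃ P : CircuitGraph n l, ∀ g ∈ S, P.Computes g

namespace JointlyComputable

variable {n k l : ℕ} {S T : Set ((Fin n → Bool) → Bool)} {a b c g : (Fin n → Bool) → Bool}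

theorem mono (h : JointlyComputable n k S) (hkl : k ≤ l) (hTS : T ⊆ S) :
    JointlyComputable n l T := by
  obtain ⟨m, hm, P, hP⟩ := h
  exact ⟨m, hm.trans hkl, P, fun g hg => hP g (hTS hg)⟩

theorem empty : JointlyComputable n 0 ∅ := ⟨0, le_rfl, .nil, by simp⟩

theorem union (hS : JointlyComputable n k S) (hT : JointlyComputable n l T) :
    JointlyComputable n (k + l) (S ∪ T) := by
  obtain ⟨k', hk, P, hP⟩ := hS
  obtain ⟨l', hl, Q, hQ⟩ := hT
  obtain ⟨R, hRP, hRQ⟩ := P.exists_append Q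
  refine ⟨k' + l', by omega, R, ?_⟩
  rintro g (hg | hg)
  · obtain ⟨i, hi⟩ := hP g hg
    exact ⟨_, fun x => (hRP x i).trans (hi x)⟩
  · obtain ⟨j, hj⟩ := hQ g hg
    exact ⟨_, fun x => (hRQ x j).trans (hj x)⟩

theorem insert_const (h : JointlyComputable n k S) (b : Bool) :
    JointlyComputable n (k + 1) (insert (fun _ => b) S) := by
  obtain ⟨m, hm, P, hP⟩ := h
  refine ⟨m + 1, by omega, P.snoc (.const b), ?_⟩
  rintro g (rfl | hg)
  exacts [P.computes_snoc_value _, (hP g hg).snoc _]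

theorem insert_gate (h : JointlyComputable n k S) (op : Bool → Bool → Bool) (ha : a ∈ S)
    (hb : b ∈ S) : JointlyComputable n (k + 1) (insert (fun x => op (a x) (b x)) S) := by
  obtain ⟨m, hm, P, hP⟩ := h
  obtain ⟨i, hi⟩ := hP a ha
  obtain ⟨j, hj⟩ := hP b hb
  refine ⟨m + 1, by omega, P.snoc (.gate op i j), ?_⟩
  rintro g (rfl | hg)
  · simpa only [CircuitNode.value, hi, hj] using P.computes_snoc_value (.gate op i j)
  · exact (hP g hg).snoc _

theorem of_circuits (As : List (BoolCircuit n)) :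
    JointlyComputable n (As.map BoolCircuit.size).sum {g | g ∈ As.map BoolCircuit.eval} := by
  induction As with
  | nil => exact empty.mono le_rfl (by simp)
  | cons A As ih =>
    have hA : JointlyComputable n A.size {A.eval} :=
      ⟨A.size, le_rfl, A.graph, by rintro g rfl; exact ⟨Fin.last _, fun _ => rfl⟩⟩
    refine (hA.union ih).mono (by simp) fun g hg => ?_
    simpa using hg

theorem exists_circuit (h : JointlyComputable n k S) (hg : g ∈ S) :
    ∃ A : BoolCircuit n, A.size ≤ k + 1 ∧ ∀ x, A.eval x = g x := by
  obtain ⟨m, hm, P, hP⟩ := h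
  obtain ⟨i, hi⟩ := hP g hg
  -- A circuit outputs its last vertex, so the value of vertex `i` is copied there.
  refine ⟨⟨m, P.snoc (.gate (fun u _ => u) i i)⟩, by simp [BoolCircuit.size, hm], fun x => ?_⟩
  exact (P.values_snoc_last _ x).trans (hi x)

theorem insert_halfAdder (h : JointlyComputable n k S) (ha : a ∈ S) (hb : b ∈ S) :
    ∃ u v : (Fin n → Bool) → Bool,
      (∀ x, (a x).toNat + (b x).toNat = (u x).toNat + 2 * (v x).toNat) ∧
      JointlyComputable n (k + 2) (insert u (insert v S)) := by
  refine ⟨fun x => xor (a x) (b x), fun x => a x && b x, fun x => ?_,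
    (h.insert_gate and ha hb).insert_gate xor (.inr ha) (.inr hb)⟩
  beta_reduce
  cases a x <;> cases b x <;> rfl

/-- Two half adders; their carries are never both `1`, so `or` adds them. -/
theorem insert_fullAdder (h : JointlyComputable n k S) (ha : a ∈ S) (hb : b ∈ S) (hc : c ∈ S) :
    ∃ u v : (Fin n → Bool) → Bool,
      (∀ x, (a x).toNat + (b x).toNat + (c x).toNat = (u x).toNat + 2 * (v x).toNat) ∧
      JointlyComputable n (k + 5) (insert u (insert v S)) := by
  obtain ⟨u₁, v₁, huv₁, h₁⟩ := h.insert_halfAdder ha hb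
  obtain ⟨u₂, v₂, huv₂, h₂⟩ := h₁.insert_halfAdder (a := u₁) (b := c) (by simp) (by simp [hc])
  have h₃ := h₂.insert_gate or (a := v₁) (b := v₂) (by simp) (by simp)
  refine ⟨u₂, fun x => v₁ x || v₂ x, fun x => ?_, h₃.mono le_rfl fun g hg => ?_⟩
  · have h₁x := huv₁ x
    have h₂x := huv₂ x
    have hc := Bool.toNat_le (c x)
    have hab : (a x).toNat + (b x).toNat ≤ 2 := Nat.add_le_add (Bool.toNat_le _) (Bool.toNat_le _)
    have hcarry : (v₁ x || v₂ x).toNat = (v₁ x).toNat + (v₂ x).toNat := by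
      cases hv₁ : v₁ x <;> cases hv₂ : v₂ x <;>
        simp only [hv₁, hv₂, Bool.or_true, Bool.or_false, Bool.toNat_true, Bool.toNat_false]
          at h₁x h₂x ⊢
      omega
    beta_reduce
    omega
  · simp only [Set.mem_insert_iff] at hg ⊢
    tauto

/-- A chain of full adders: the sum bit of each one is an input of the next one, and the carries
are collected in `C`. -/
theorem exists_compress (h : JointlyComputable n k S) (ha : a ∈ S)
    (L : List ((Fin n → Bool) → Bool)) (hL : ∀ g ∈ L, g ∈ S) :
    ∃ (u : (Fin n → Bool) → Bool) (C : List ((Fin n → Bool) → Bool)),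
      C.length ≤ (L.length + 1) / 2 ∧
      (∀ x, (a x).toNat + L.countP (· x) = (u x).toNat + 2 * C.countP (· x)) ∧
      JointlyComputable n (k + 5 * ((L.length + 1) / 2)) ({g | g ∈ C} ∪ S) := by
  induction L using List.twoStepInduction generalizing k S a with
  | nil => exact ⟨a, [], by simp, by simp, h.mono (by simp) (by simp)⟩
  | singleton b =>
    obtain ⟨u, v, huv, h'⟩ := h.insert_halfAdder ha (hL b (by simp))
    refine ⟨u, [v], by simp, fun x => ?_, h'.mono (by simp) fun g hg => ?_⟩
    · simpa [List.countP_cons, Bool.toNat, Bool.cond_eq_ite] using huv x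
    · simp only [Set.mem_union, Set.mem_ofPred_eq, List.mem_singleton, Set.mem_insert_iff] at hg ⊢
      tauto
  | cons_cons b c L ih _ =>
    obtain ⟨u, v, huv, h'⟩ := h.insert_fullAdder ha (hL b (by simp)) (hL c (by simp))
    obtain ⟨t, C, hC, hcount, hcomp⟩ := ih h' (Set.mem_insert _ _) fun g hg =>
      .inr (.inr (hL g (by simp [hg])))
    refine ⟨t, v :: C, ?_, fun x => ?_, hcomp.mono ?_ fun g hg => ?_⟩
    · simp only [List.length_cons]; omega
    · have huvx := huv x
      have hx := hcount x
      simp only [List.countP_cons, Bool.toNat, Bool.cond_eq_ite] at huvx hx ⊢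
      omega
    · simp only [List.length_cons]; omega
    · simp only [Set.mem_union, Set.mem_ofPred_eq, List.mem_cons, Set.mem_insert_iff] at hg ⊢
      tauto

theorem threshold (h : JointlyComputable n k S) (L : List ((Fin n → Bool) → Bool))
    (hL : ∀ g ∈ L, g ∈ S) (τ : ℕ) :
    JointlyComputable n (k + 12 * L.length + 1) {fun x => decide (τ ≤ L.countP (· x))} := by
  induction hN : L.length using Nat.strong_induction_on generalizing k S L τ with
  | _ N ih =>
  match L with
  | [] =>
    exact (h.insert_const (decide (τ ≤ 0))).mono (by omega) (by simp)
  | [a] =>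
    have ha : a ∈ S := hL a (by simp)
    refine (h.insert_gate (fun u _ => decide (τ ≤ u.toNat)) ha ha).mono (by omega) ?_
    simp only [Set.singleton_subset_iff, Set.mem_insert_iff]
    left
    funext x
    cases hx : a x <;> simp [hx]
  | a :: b :: L =>
    simp only [List.length_cons] at hN
    -- An odd threshold is made even by counting a constant bit; then the sum bit is irrelevant.
    obtain ⟨u, C, hC, hcount, hcomp⟩ := (h.insert_const (decide (Odd τ))).exists_compress
      (Set.mem_insert _ _) (a :: b :: L) fun g hg => .inr (hL g hg)
    simp only [List.length_cons] at hC hcomp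
    refine (ih C.length (by omega) hcomp C (fun g hg => .inl hg) ((τ + 1) / 2) rfl).mono
      (by omega) ?_
    simp only [Set.singleton_subset_iff, Set.mem_singleton_iff]
    funext x
    have hu := Bool.toNat_le (u x)
    have hx := hcount x
    have hparity : (decide (Odd τ)).toNat = τ % 2 := by
      rcases Nat.mod_two_eq_zero_or_one τ with h | h <;> simp [Nat.odd_iff, h]
    rw [decide_eq_decide]
    omega

end JointlyComputable

namespace BoolCircuit

variable {n : ℕ} {ι : Type*} {l : List ι}

theorem exists_threshold (hl : l ≠ []) (C : ι → BoolCircuit n) (τ : ℕ) :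
    ∃ A : BoolCircuit n, A.size ≤ 15 * (l.map fun a => (C a).size).sum ∧
      ∀ x, A.eval x = decide (τ ≤ l.countP fun a => (C a).eval x) := by
  have hlen : l.length ≤ (l.map fun a => (C a).size).sum := by
    simpa using List.card_nsmul_le_sum (l.map fun a => (C a).size) 1 (by simp [size])
  have hpos := List.length_pos_iff.2 hl
  obtain ⟨A, hA, heval⟩ := ((JointlyComputable.of_circuits (l.map C)).threshold
    ((l.map C).map eval) (fun _ hg => hg) τ).exists_circuit (Set.mem_singleton _)
  simp only [List.length_map, List.map_map, Function.comp_def] at hA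
  refine ⟨A, by omega, fun x => ?_⟩
  simp only [heval, List.countP_map, Function.comp_def]

theorem exists_threshold_of_size_le (hl : l ≠ []) {C : ι → BoolCircuit n} {B : ℝ}
    (hC : ∀ a ∈ l, ((C a).size : ℝ) ≤ B) (τ : ℕ) :
    ∃ A : BoolCircuit n, (A.size : ℝ) ≤ 15 * (l.length * B) ∧
      ∀ x, A.eval x = decide (τ ≤ l.countP fun a => (C a).eval x) := by
  obtain ⟨A, hA, heval⟩ := exists_threshold hl C τ
  have hsum : ((l.map fun a => (C a).size).sum : ℝ) ≤ l.length * B := by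
    simpa [Nat.cast_list_sum, Function.comp_def] using
      List.sum_le_card_nsmul (l.map fun a => ((C a).size : ℝ)) B (by simpa using hC)
  refine ⟨A, ?_, heval⟩
  calc (A.size : ℝ) ≤ 15 * (l.map fun a => (C a).size).sum := mod_cast hA
    _ ≤ 15 * (l.length * B) := by gcongr

end BoolCircuit

/-- The weight `min 1 (exp u)` that boosting gives to a point whose margin falls short by `u`. The
cap keeps the weights below `1`, so that they form a density. -/
noncomputable def cappedExp (u : ℝ) : ℝ := min 1 (Real.exp u)

/-- The convex primitive of `cappedExp`, equal to `exp u` for `u ≤ 0` and to `1 + u` for `0 ≤ u`. -/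
noncomputable def cappedExpPrimitive (u : ℝ) : ℝ := Real.exp (min u 0) + max u 0

theorem cappedExp_nonneg (u : ℝ) : 0 ≤ cappedExp u := le_min zero_le_one (Real.exp_pos u).le

theorem cappedExp_le_one (u : ℝ) : cappedExp u ≤ 1 := min_le_left _ _

theorem cappedExp_le_exp (u : ℝ) : cappedExp u ≤ Real.exp u := min_le_right _ _

theorem cappedExp_of_nonpos {u : ℝ} (hu : u ≤ 0) : cappedExp u = Real.exp u :=
  min_eq_right (Real.exp_le_one_iff.2 hu)

theorem cappedExp_of_nonneg {u : ℝ} (hu : 0 ≤ u) : cappedExp u = 1 :=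
  min_eq_left (Real.one_le_exp hu)

theorem continuous_cappedExp : Continuous cappedExp := by unfold cappedExp; fun_prop

theorem cappedExpPrimitive_of_nonpos {u : ℝ} (hu : u ≤ 0) :
    cappedExpPrimitive u = Real.exp u := by
  simp [cappedExpPrimitive, hu]

theorem cappedExpPrimitive_of_nonneg {u : ℝ} (hu : 0 ≤ u) : cappedExpPrimitive u = 1 + u := by
  simp [cappedExpPrimitive, hu]

theorem continuous_cappedExpPrimitive : Continuous cappedExpPrimitive := by
  unfold cappedExpPrimitive; fun_prop

theorem cappedExpPrimitive_nonneg (u : ℝ) : 0 ≤ cappedExpPrimitive u :=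
  add_nonneg (Real.exp_pos _).le (le_max_right _ _)

theorem le_cappedExpPrimitive (u : ℝ) : u ≤ cappedExpPrimitive u :=
  (le_max_left u 0).trans (le_add_of_nonneg_left (Real.exp_pos _).le)

theorem cappedExpPrimitive_le_one_add_abs (u : ℝ) : cappedExpPrimitive u ≤ 1 + |u| :=
  add_le_add (Real.exp_le_one_iff.2 (min_le_right _ _)) (max_le (le_abs_self u) (abs_nonneg u))

theorem cappedExpPrimitive_tangent_le (u w : ℝ) :
    cappedExpPrimitive u + cappedExp u * (w - u) ≤ cappedExpPrimitive w := by
  have exp_tangent (y : ℝ) : Real.exp u * (y - u + 1) ≤ Real.exp y := by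
    calc Real.exp u * (y - u + 1) ≤ Real.exp u * Real.exp (y - u) := by
          gcongr; exact Real.add_one_le_exp _
      _ = Real.exp y := by rw [← Real.exp_add]; ring_nf
  rcases le_total u 0 with hu | hu
  · rw [cappedExp_of_nonpos hu, cappedExpPrimitive_of_nonpos hu]
    rcases le_total w 0 with hw | hw
    · rw [cappedExpPrimitive_of_nonpos hw]
      linarith [exp_tangent w]
    · rw [cappedExpPrimitive_of_nonneg hw]
      have tangent_zero := exp_tangent 0
      rw [Real.exp_zero] at tangent_zero
      have slope_le := mul_le_of_le_one_left hw (Real.exp_le_one_iff.2 hu)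
      linarith
  · rw [cappedExp_of_nonneg hu, cappedExpPrimitive_of_nonneg hu]
    rcases le_total w 0 with hw | hw
    · rw [cappedExpPrimitive_of_nonpos hw]
      linarith [Real.add_one_le_exp w]
    · rw [cappedExpPrimitive_of_nonneg hw]
      linarith

theorem cappedExpPrimitive_add_le (u : ℝ) {d : ℝ} (hd : |d| ≤ 1) :
    cappedExpPrimitive (u + d) ≤ cappedExpPrimitive u + cappedExp u * (d + d ^ 2) := by
  have exp_le {y : ℝ} (hy : |y| ≤ 1) : Real.exp y ≤ 1 + y + y ^ 2 := by
    linarith [(abs_le.1 (Real.abs_exp_sub_one_sub_id_le hy)).2]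
  have le_exp (y : ℝ) : cappedExpPrimitive y ≤ Real.exp y := by
    rcases le_total y 0 with hy | hy
    · exact (cappedExpPrimitive_of_nonpos hy).le
    · rw [cappedExpPrimitive_of_nonneg hy, add_comm]
      exact Real.add_one_le_exp y
  rcases le_total u 0 with hu | hu
  · rw [cappedExp_of_nonpos hu, cappedExpPrimitive_of_nonpos hu]
    calc cappedExpPrimitive (u + d) ≤ Real.exp u * Real.exp d := by
          rw [← Real.exp_add]; exact le_exp _
      _ ≤ Real.exp u * (1 + d + d ^ 2) := by gcongr; exact exp_le hd
      _ = Real.exp u + Real.exp u * (d + d ^ 2) := by ring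
  · rw [cappedExp_of_nonneg hu, cappedExpPrimitive_of_nonneg hu]
    rcases le_total (u + d) 0 with h | h
    · obtain ⟨hd_ge, -⟩ := abs_le.1 hd
      have hexp := exp_le (y := u + d) (abs_le.2 ⟨by linarith, by linarith⟩)
      rw [cappedExpPrimitive_of_nonpos h]
      nlinarith
    · rw [cappedExpPrimitive_of_nonneg h]
      nlinarith [sq_nonneg d]

/-- `h` is a density of mass `ε` on the probability space `(X, μ)`: it has values in `[0, 1]` and
integral `ε`. It plays the role of the conditional probability of an event given the point. -/
structure IsDensityOfMass {X : Type*} [MeasurableSpace X] (μ : Measure X) (ε : ℝ) (h : X → ℝ) :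
    Prop where
  measurable : Measurable h
  nonneg : ∀ x, 0 ≤ h x
  le_one : ∀ x, h x ≤ 1
  integral_eq : ∫ x, h x ∂μ = ε

/-- The potential of boosting: `F x` is the unnormalized logarithmic weight of the point `x`, and
`r` is the multiplier of the constraint that the weights `cappedExp (F x - r)` have mass `ε`. -/
noncomputable def boostingPotential {X : Type*} [MeasurableSpace X] (μ : Measure X) (ε : ℝ)
    (F : X → ℝ) (r : ℝ) : ℝ :=
  ε * r + ∫ x, cappedExpPrimitive (F x - r) ∂μ

theorem abs_sum_map_le_length {X ι : Type*} {χ : ι → X → ℝ} (hχ : ∀ a x, |χ a x| ≤ 1)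
    (l : List ι) (x : X) : |(l.map (χ · x)).sum| ≤ l.length := by
  induction l with
  | nil => simp
  | cons a l ih =>
    rw [List.map_cons, List.sum_cons, List.length_cons, Nat.cast_succ, add_comm (l.length : ℝ)]
    exact (abs_add_le _ _).trans (add_le_add (hχ a x) ih)

theorem measurable_sum_map {X ι : Type*} [MeasurableSpace X] {χ : ι → X → ℝ}
    (hχm : ∀ a, Measurable (χ a)) (l : List ι) : Measurable fun x => (l.map (χ · x)).sum := by
  induction l with
  | nil => exact measurable_const
  | cons a l ih =>
    simp only [List.map_cons, List.sum_cons]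
    exact (hχm a).add ih

section Boosting

variable {X ι : Type*} [MeasurableSpace X] {μ : Measure X} {F G h : X → ℝ} {ε δ : ℝ}

theorem IsDensityOfMass.integrable [IsFiniteMeasure μ] (hh : IsDensityOfMass μ ε h) :
    Integrable h μ :=
  .of_bound hh.measurable.aestronglyMeasurable 1 (.of_forall fun x => by
    rw [Real.norm_of_nonneg (hh.nonneg x)]; exact hh.le_one x)

theorem IsDensityOfMass.integrable_mul [IsFiniteMeasure μ] (hh : IsDensityOfMass μ ε h)
    (hG : Integrable G μ) : Integrable (fun x => h x * G x) μ :=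
  hG.bdd_mul (c := 1) hh.measurable.aestronglyMeasurable (.of_forall fun x => by
    rw [Real.norm_of_nonneg (hh.nonneg x)]; exact hh.le_one x)

theorem integrable_cappedExpPrimitive_sub [IsFiniteMeasure μ] (hF : Integrable F μ) (r : ℝ) :
    Integrable (fun x => cappedExpPrimitive (F x - r)) μ := by
  have hFr : Integrable (fun x => F x - r) μ := hF.sub (integrable_const r)
  refine ((integrable_const 1).add hFr.abs).mono'
    (continuous_cappedExpPrimitive.comp_aestronglyMeasurable hFr.aestronglyMeasurable)
    (.of_forall fun x => ?_)
  rw [Real.norm_of_nonneg (cappedExpPrimitive_nonneg _)]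
  exact cappedExpPrimitive_le_one_add_abs _

theorem exists_isDensityOfMass_cappedExp_sub [IsProbabilityMeasure μ] (hF : Measurable F) {B : ℝ}
    (hB : ∀ x, |F x| ≤ B) (hε : 0 < ε) (hε1 : ε ≤ 1) :
    ∃ r, IsDensityOfMass μ ε fun x => cappedExp (F x - r) := by
  have hmeas (r : ℝ) : Measurable fun x => cappedExp (F x - r) :=
    continuous_cappedExp.measurable.comp (hF.sub_const r)
  have hbound (r x : ℝ) : ‖cappedExp (x - r)‖ ≤ 1 := by
    rw [Real.norm_of_nonneg (cappedExp_nonneg _)]; exact cappedExp_le_one _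
  have hcont : Continuous fun r => ∫ x, cappedExp (F x - r) ∂μ :=
    continuous_of_dominated (fun r => (hmeas r).aestronglyMeasurable)
      (fun r => .of_forall fun x => hbound r (F x)) (integrable_const 1)
      (.of_forall fun x => continuous_cappedExp.comp (continuous_const.sub continuous_id))
  obtain ⟨r, hr⟩ : ∃ r, ∫ x, cappedExp (F x - r) ∂μ = ε := by
    refine mem_range_of_exists_le_of_exists_ge hcont ⟨B - Real.log ε, ?_⟩ ⟨-B, ?_⟩
    · calc ∫ x, cappedExp (F x - (B - Real.log ε)) ∂μ ≤ ∫ _, ε ∂μ := by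
            refine integral_mono (.of_bound (hmeas _).aestronglyMeasurable 1
              (.of_forall fun x => hbound _ _)) (integrable_const ε) fun x => ?_
            refine (cappedExp_le_exp _).trans ((Real.le_log_iff_exp_le hε).1 ?_)
            linarith [(abs_le.1 (hB x)).2]
        _ = ε := by simp
    · have hone (x : X) : cappedExp (F x - -B) = 1 :=
        cappedExp_of_nonneg (by linarith [(abs_le.1 (hB x)).1])
      simpa only [hone, integral_const, probReal_univ, one_smul] using hε1
  exact ⟨r, hmeas r, fun x => cappedExp_nonneg _, fun x => cappedExp_le_one _, hr⟩

/-- `boostingPotential μ ε F` is convex, and its derivative `ε - ∫ x, cappedExp (F x - r) ∂μ`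
vanishes at the point considered here. -/
theorem boostingPotential_le_of_isDensityOfMass [IsFiniteMeasure μ] (hF : Integrable F μ) {r : ℝ}
    (hr : IsDensityOfMass μ ε fun x => cappedExp (F x - r)) (r' : ℝ) :
    boostingPotential μ ε F r ≤ boostingPotential μ ε F r' := by
  have hprim := integrable_cappedExpPrimitive_sub hF r
  have hlin : Integrable (fun x => cappedExp (F x - r) * (r - r')) μ := hr.integrable.mul_const _
  have htangent : ∫ x, (cappedExpPrimitive (F x - r) + cappedExp (F x - r) * (r - r')) ∂μ ≤
      ∫ x, cappedExpPrimitive (F x - r') ∂μ := by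
    refine integral_mono (hprim.add hlin) (integrable_cappedExpPrimitive_sub hF r') fun x => ?_
    simpa using cappedExpPrimitive_tangent_le (F x - r) (F x - r')
  rw [integral_add hprim hlin, integral_mul_const, hr.integral_eq] at htangent
  unfold boostingPotential
  linarith

theorem boostingPotential_add_le [IsFiniteMeasure μ] (hF : Integrable F μ) (hGm : Measurable G)
    {c : ℝ} (hG : ∀ x, |G x| ≤ c) (hc : c ≤ 1) {r : ℝ}
    (hr : IsDensityOfMass μ ε fun x => cappedExp (F x - r)) :
    boostingPotential μ ε (F + G) r ≤
      boostingPotential μ ε F r + ∫ x, cappedExp (F x - r) * G x ∂μ + ε * c ^ 2 := by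
  have hGint : Integrable G μ := .of_bound hGm.aestronglyMeasurable c (.of_forall hG)
  have hprim := integrable_cappedExpPrimitive_sub hF r
  have hsum : Integrable (fun x => cappedExpPrimitive (F x - r) + cappedExp (F x - r) * G x) μ :=
    hprim.add (hr.integrable_mul hGint)
  have hquad := hr.integrable.mul_const (c ^ 2)
  have htaylor : ∫ x, cappedExpPrimitive ((F + G) x - r) ∂μ ≤
      ∫ x, (cappedExpPrimitive (F x - r) + cappedExp (F x - r) * G x +
        cappedExp (F x - r) * c ^ 2) ∂μ := by
    refine integral_mono (integrable_cappedExpPrimitive_sub (hF.add hGint) r)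
      (hsum.add hquad) fun x => ?_
    have hGc : G x ^ 2 ≤ c ^ 2 := sq_le_sq.2 ((hG x).trans (le_abs_self c))
    calc cappedExpPrimitive ((F + G) x - r) = cappedExpPrimitive (F x - r + G x) := by
          rw [Pi.add_apply, add_sub_right_comm]
      _ ≤ cappedExpPrimitive (F x - r) + cappedExp (F x - r) * (G x + G x ^ 2) :=
          cappedExpPrimitive_add_le _ ((hG x).trans hc)
      _ ≤ cappedExpPrimitive (F x - r) + cappedExp (F x - r) * (G x + c ^ 2) := by
          gcongr; exact cappedExp_nonneg _
      _ = _ := by ring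
  rw [integral_add hsum hquad, integral_add hprim (hr.integrable_mul hGint), integral_mul_const,
    hr.integral_eq] at htaylor
  unfold boostingPotential
  linarith

variable [IsProbabilityMeasure μ] {χ : ι → X → ℝ}

theorem exists_boostingPotential_add_le (hχm : ∀ a, Measurable (χ a)) (hχ : ∀ a x, |χ a x| ≤ 1)
    (hε : 0 < ε) (hε1 : ε ≤ 1) (hδ : 0 ≤ δ) (hδ1 : δ ≤ 1)
    (hweak : ∀ h, IsDensityOfMass μ ε h → ∃ a, ε * δ ≤ ∫ x, h x * χ a x ∂μ)
    (hF : Measurable F) {B : ℝ} (hB : ∀ x, |F x| ≤ B) (r : ℝ) :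
    ∃ a r', boostingPotential μ ε (F + fun x => -(δ / 2) * χ a x) r' ≤
      boostingPotential μ ε F r - ε * δ ^ 2 / 4 := by
  obtain ⟨r', hr'⟩ := exists_isDensityOfMass_cappedExp_sub (μ := μ) hF hB hε hε1
  obtain ⟨a, ha⟩ := hweak _ hr'
  have hFint : Integrable F μ := .of_bound hF.aestronglyMeasurable B (.of_forall hB)
  have hsmall (x : X) : |-(δ / 2) * χ a x| ≤ δ / 2 := by
    rw [abs_mul, abs_neg, abs_of_nonneg (by positivity)]
    exact mul_le_of_le_one_right (by positivity) (hχ a x)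
  have hadd := boostingPotential_add_le hFint ((hχm a).const_mul (-(δ / 2))) hsmall
    (by linarith) hr'
  simp only [mul_left_comm _ (-(δ / 2)), integral_const_mul] at hadd
  have hmin := boostingPotential_le_of_isDensityOfMass hFint hr' r
  exact ⟨a, r', by nlinarith⟩

theorem exists_list_boostingPotential_le (hχm : ∀ a, Measurable (χ a))
    (hχ : ∀ a x, |χ a x| ≤ 1) (hε : 0 < ε) (hε1 : ε ≤ 1) (hδ : 0 ≤ δ) (hδ1 : δ ≤ 1)
    (hweak : ∀ h, IsDensityOfMass μ ε h → ∃ a, ε * δ ≤ ∫ x, h x * χ a x ∂μ) (t : ℕ) :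
    ∃ (l : List ι) (r : ℝ), l.length = t ∧
      boostingPotential μ ε (fun x => -(δ / 2) * (l.map (χ · x)).sum) r ≤
        ε * (1 - Real.log ε - t * δ ^ 2 / 4) := by
  induction t with
  | zero =>
    have hprim : cappedExpPrimitive (Real.log ε) = ε := by
      rw [cappedExpPrimitive_of_nonpos (Real.log_nonpos hε.le hε1), Real.exp_log hε]
    refine ⟨[], -Real.log ε, rfl, le_of_eq ?_⟩
    simp only [boostingPotential, List.map_nil, List.sum_nil, mul_zero, zero_sub, neg_neg, hprim,
      integral_const, probReal_univ, one_smul]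
    push_cast
    ring
  | succ t ih =>
    obtain ⟨l, r, hlen, hr⟩ := ih
    obtain ⟨a, r', hr'⟩ := exists_boostingPotential_add_le hχm hχ hε hε1 hδ hδ1 hweak
      ((measurable_sum_map hχm l).const_mul (-(δ / 2))) (B := δ / 2 * l.length) (fun x => by
        rw [abs_mul, abs_neg, abs_of_nonneg (by positivity)]
        gcongr
        exact abs_sum_map_le_length hχ l x) r
    refine ⟨a :: l, r', by simp [hlen], ?_⟩
    have hcons : (fun x => -(δ / 2) * ((a :: l).map (χ · x)).sum) =
        (fun x => -(δ / 2) * (l.map (χ · x)).sum) + fun x => -(δ / 2) * χ a x := by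
      funext x
      simp only [List.map_cons, List.sum_cons, Pi.add_apply]
      ring
    rw [hcons]
    push_cast
    linarith

theorem exists_list_lintegral_margin_lt (hχm : ∀ a, Measurable (χ a))
    (hχ : ∀ a x, |χ a x| ≤ 1) (hε : 0 < ε) (hε1 : ε ≤ 1) (hδ : 0 < δ) (hδ1 : δ ≤ 1)
    (hweak : ∀ h, IsDensityOfMass μ ε h → ∃ a, ε * δ ≤ ∫ x, h x * χ a x ∂μ) {t : ℕ}
    (ht : 4 * (1 - Real.log ε) < t * δ ^ 2) :
    ∃ (l : List ι) (θ : ℝ), l.length = t ∧ 0 < θ ∧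
      ∫⁻ x, ENNReal.ofReal (θ - (l.map (χ · x)).sum) ∂μ < ENNReal.ofReal (ε * θ) := by
  obtain ⟨l, r, hlen, hr⟩ := exists_list_boostingPotential_le hχm hχ hε hε1 hδ.le hδ1 hweak t
  set F : X → ℝ := fun x => -(δ / 2) * (l.map (χ · x)).sum
  have hint : Integrable F μ :=
    (Integrable.of_bound (measurable_sum_map hχm l).aestronglyMeasurable l.length
      (.of_forall fun x => abs_sum_map_le_length hχ l x)).const_mul _
  have hneg : boostingPotential μ ε F r < 0 := hr.trans_lt (mul_neg_of_pos_of_neg hε (by linarith))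
  have hprim_nonneg : 0 ≤ ∫ x, cappedExpPrimitive (F x - r) ∂μ :=
    integral_nonneg fun x => cappedExpPrimitive_nonneg _
  have hlt : ∫ x, cappedExpPrimitive (F x - r) ∂μ < ε * -r := by
    unfold boostingPotential at hneg
    linarith
  have hr0 : 0 < -r := pos_of_mul_pos_right (hprim_nonneg.trans_lt hlt) hε.le
  refine ⟨l, 2 / δ * -r, hlen, by positivity, ?_⟩
  calc ∫⁻ x, ENNReal.ofReal (2 / δ * -r - (l.map (χ · x)).sum) ∂μ
      = ∫⁻ x, ENNReal.ofReal (2 / δ * (F x - r)) ∂μ := by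
        refine lintegral_congr fun x => congrArg ENNReal.ofReal ?_
        simp only [F]
        field_simp
        ring
    _ ≤ ∫⁻ x, ENNReal.ofReal (2 / δ * cappedExpPrimitive (F x - r)) ∂μ := by
        gcongr
        exact le_cappedExpPrimitive _
    _ = ENNReal.ofReal (2 / δ * ∫ x, cappedExpPrimitive (F x - r) ∂μ) := by
        rw [← integral_const_mul, ofReal_integral_eq_lintegral_ofReal
          ((integrable_cappedExpPrimitive_sub hint r).const_mul _)
          (.of_forall fun x => mul_nonneg (by positivity) (cappedExpPrimitive_nonneg _))]
    _ < ENNReal.ofReal (ε * (2 / δ * -r)) := by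
        rw [ENNReal.ofReal_lt_ofReal_iff (by positivity), mul_left_comm ε]
        gcongr

end Boosting

/-- The encoding of `true` and `false` as `1` and `-1`. The product of two signs is `1` if the bits
agree and `-1` otherwise, so correlations measure agreement. -/
def boolSign (b : Bool) : ℝ := if b then 1 else -1

theorem abs_boolSign_mul_boolSign_le_one (a b : Bool) : |boolSign a * boolSign b| ≤ 1 := by
  cases a <;> cases b <;> simp [boolSign]

theorem boolSign_mul_boolSign (a b : Bool) :
    boolSign a * boolSign b = 2 * (if b = a then 1 else 0) - 1 := by
  cases a <;> cases b <;> norm_num [boolSign]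

theorem sum_map_boolSign {α : Type*} (p : α → Bool) (l : List α) :
    (l.map fun a => boolSign (p a)).sum = 2 * l.countP p - l.length := by
  induction l with
  | nil => simp
  | cons a l ih =>
    rw [List.map_cons, List.sum_cons, ih, List.countP_cons, List.length_cons, boolSign]
    cases p a <;> simp only [Bool.false_eq_true, ↓reduceIte] <;> push_cast <;> ring

section Threshold

variable {X ι : Type*} [MeasurableSpace X] {μ : Measure X} {f : X → Bool} {ε δ : ℝ}

/-- Average over a uniformly random threshold in `[-θ, θ]`: the threshold errs on `x` with
probability at most `(θ - boolSign (f x) * σ x) / (2 * θ)`. -/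
theorem exists_measure_threshold_ne_lt [SFinite μ] (hf : Measurable f) {σ : X → ℝ}
    (hσ : Measurable σ) {θ : ℝ} (hθ : 0 < θ)
    (hmargin : ∫⁻ x, ENNReal.ofReal (θ - boolSign (f x) * σ x) ∂μ < ENNReal.ofReal (ε * θ)) :
    ∃ r : ℝ, μ {x | decide (r < σ x) ≠ f x} < ENNReal.ofReal (ε / 2) := by
  by_contra! herr
  let ν : Measure ℝ := volume.restrict (Set.Icc (-θ) θ)
  let S : Set (ℝ × X) := {p | decide (p.1 < σ p.2) ≠ f p.2}
  have hS : MeasurableSet S := by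
    have hdecide : Measurable fun p : ℝ × X => decide (p.1 < σ p.2) :=
      measurable_to_bool (by
        simpa [Set.preimage] using measurableSet_lt measurable_fst (hσ.comp measurable_snd))
    exact (measurableSet_eq_fun hdecide (hf.comp measurable_snd)).compl
  have hslice (x : X) :
      ν ((fun r => (r, x)) ⁻¹' S) ≤ ENNReal.ofReal (θ - boolSign (f x) * σ x) := by
    rw [Measure.restrict_apply (measurable_prodMk_right hS)]
    cases hfx : f x
    · rw [show θ - boolSign false * σ x = σ x - -θ by simp [boolSign]; ring, ← Real.volume_Icc]
      refine measure_mono fun r ⟨hr, hrθ⟩ => ⟨hrθ.1, ?_⟩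
      simp only [S, Set.mem_preimage, Set.mem_ofPred_eq, hfx] at hr
      simpa using le_of_lt (by simpa using hr)
    · rw [show θ - boolSign true * σ x = θ - σ x by simp [boolSign], ← Real.volume_Icc]
      refine measure_mono fun r ⟨hr, hrθ⟩ => ⟨?_, hrθ.2⟩
      simpa [S, hfx] using hr
  refine hmargin.not_ge ?_
  calc ENNReal.ofReal (ε * θ) = ∫⁻ _, ENNReal.ofReal (ε / 2) ∂ν := by
        rw [lintegral_const, Measure.restrict_apply_univ, Real.volume_Icc,
          ← ENNReal.ofReal_mul' (by linarith)]
        ring_nf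
    _ ≤ ∫⁻ r, μ (Prod.mk r ⁻¹' S) ∂ν := lintegral_mono herr
    _ = ∫⁻ x, ν ((fun r => (r, x)) ⁻¹' S) ∂μ := by
        rw [← Measure.prod_apply hS, Measure.prod_apply_symm hS]
    _ ≤ ∫⁻ x, ENNReal.ofReal (θ - boolSign (f x) * σ x) ∂μ := lintegral_mono hslice

theorem exists_nat_forall_lt_natCast_iff (ρ : ℝ) : ∃ τ : ℕ, ∀ N : ℕ, ρ < N ↔ τ ≤ N :=
  ⟨(⌊ρ⌋ + 1).toNat, fun N => by
    rw [Int.toNat_le, Int.add_one_le_iff, Int.floor_lt, Int.cast_natCast]⟩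

theorem exists_threshold_of_weakLearner [IsProbabilityMeasure μ] {g : ι → X → Bool}
    (hf : Measurable f) (hg : ∀ a, Measurable (g a)) (hε : 0 < ε) (hε1 : ε ≤ 1) (hδ : 0 < δ)
    (hδ1 : δ ≤ 1)
    (hweak : ∀ h, IsDensityOfMass μ ε h →
      ∃ a, ε * δ ≤ ∫ x, h x * (boolSign (f x) * boolSign (g a x)) ∂μ) {t : ℕ}
    (ht : 4 * (1 - Real.log ε) < t * δ ^ 2) :
    ∃ (l : List ι) (τ : ℕ), l.length = t ∧
      μ {x | decide (τ ≤ l.countP (g · x)) ≠ f x} < ENNReal.ofReal (ε / 2) := by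
  have hsign : Measurable boolSign := measurable_of_finite _
  obtain ⟨l, θ, hlen, hθ, hmargin⟩ := exists_list_lintegral_margin_lt
    (fun a => (hsign.comp hf).mul (hsign.comp (hg a)))
    (fun a x => abs_boolSign_mul_boolSign_le_one (f x) (g a x)) hε hε1 hδ hδ1 hweak ht
  simp only [Pi.mul_apply, Function.comp_apply, List.sum_map_mul_left] at hmargin
  obtain ⟨r, hr⟩ := exists_measure_threshold_ne_lt hf
    (measurable_sum_map (fun a => hsign.comp (hg a)) l) hθ hmargin
  obtain ⟨τ, hτ⟩ := exists_nat_forall_lt_natCast_iff ((r + l.length) / 2)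
  refine ⟨l, τ, hlen, ?_⟩
  have hdecide (x : X) : τ ≤ l.countP (g · x) ↔ r < (l.map fun a => boolSign (g a x)).sum := by
    rw [← hτ, sum_map_boolSign (g · x), div_lt_iff₀ two_pos, lt_sub_iff_add_lt, mul_comm]
  simpa only [hdecide, Function.comp_apply] using hr

end Threshold

theorem exists_nat_boosting_rounds {ε δ : ℝ} (hε : 0 < ε) (hε1 : ε ≤ 1) (hδ : 0 < δ)
    (hδ1 : δ ≤ 1) :
    ∃ t : ℕ, 4 * (1 - Real.log ε) < t * δ ^ 2 ∧ t * δ ^ 2 ≤ 8 * Real.log (2 / ε) := by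
  have hlog : Real.log ε ≤ 0 := Real.log_nonpos hε.le hε1
  have hlog_div : Real.log (2 / ε) = Real.log 2 - Real.log ε := Real.log_div two_ne_zero hε.ne'
  have hδ2 : δ ^ 2 ≤ 1 := pow_le_one₀ hδ.le hδ1
  have hfloor : ⌊4 * (1 - Real.log ε) / δ ^ 2⌋₊ * δ ^ 2 ≤ 4 * (1 - Real.log ε) :=
    (le_div_iff₀ (by positivity)).1 (Nat.floor_le (div_nonneg (by linarith) (by positivity)))
  refine ⟨⌊4 * (1 - Real.log ε) / δ ^ 2⌋₊ + 1, ?_, ?_⟩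
  · rw [← div_lt_iff₀ (by positivity)]
    exact_mod_cast Nat.lt_floor_add_one _
  · push_cast
    linarith [Real.log_two_gt_d9]

/-- The constant is `1 / (15 * 8)`: a threshold circuit is `15` times larger than its parts, and
there are at most `8 * log (2 / ε) / δ ^ 2` rounds of boosting. -/
theorem BoolCircuit.exists_hardcore_density {n s : ℕ} {V : Measure (Fin n → Bool)}
    [IsProbabilityMeasure V] {f : (Fin n → Bool) → Bool} {ε δ : ℝ} (hε : 0 < ε) (hε1 : ε ≤ 1)
    (hδ : 0 < δ) (hδ1 : δ ≤ 1)
    (hV : ∀ A : BoolCircuit n, A.size ≤ s → V.real {x | A.eval x = f x} ≤ 1 - ε / 2) :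
    ∃ h, IsDensityOfMass V ε h ∧ ∀ A : BoolCircuit n,
      (A.size : ℝ) ≤ 1 / 120 * (s * δ ^ 2 / Real.log (2 / ε)) →
        ∫ x, h x * (boolSign (f x) * boolSign (A.eval x)) ∂V ≤ ε * δ := by
  set B := 1 / 120 * (s * δ ^ 2 / Real.log (2 / ε)) with hB
  by_contra! hnot
  have hweak (h : (Fin n → Bool) → ℝ) (hh : IsDensityOfMass V ε h) :
      ∃ A : {A : BoolCircuit n // (A.size : ℝ) ≤ B},
        ε * δ ≤ ∫ x, h x * (boolSign (f x) * boolSign (A.1.eval x)) ∂V := by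
    obtain ⟨A, hA, hlt⟩ := hnot h hh
    exact ⟨⟨A, hA⟩, hlt.le⟩
  obtain ⟨t, hround, ht⟩ := exists_nat_boosting_rounds hε hε1 hδ hδ1
  obtain ⟨l, τ, hlen, herr⟩ := exists_threshold_of_weakLearner (measurable_of_finite f)
    (fun _ => measurable_of_finite _) hε hε1 hδ hδ1 hweak hround
  have hlog : 0 < Real.log (2 / ε) := Real.log_pos ((one_lt_div hε).2 (by linarith))
  have hl : l ≠ [] := by
    rintro rfl
    rw [← hlen, List.length_nil, Nat.cast_zero, zero_mul] at hround
    linarith [Real.log_nonpos hε.le hε1]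
  obtain ⟨A, hA, heval⟩ :=
    BoolCircuit.exists_threshold_of_size_le hl (C := Subtype.val) (fun a _ => a.2) τ
  have hAs : (A.size : ℝ) ≤ s := by
    calc (A.size : ℝ) ≤ 15 * (t * B) := hlen ▸ hA
      _ = s * (t * δ ^ 2) / (8 * Real.log (2 / ε)) := by rw [hB]; field_simp; ring
      _ ≤ s * (8 * Real.log (2 / ε)) / (8 * Real.log (2 / ε)) := by gcongr
      _ = s := by field_simp
  have hagree := hV A (mod_cast hAs)
  have hdisagree : V.real {x | A.eval x ≠ f x} < ε / 2 := by
    refine (ENNReal.lt_ofReal_iff_toReal_lt (measure_ne_top _ _)).1 ?_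
    simpa only [heval] using herr
  have hcompl := probReal_compl_eq_one_sub (μ := V) (s := {x | A.eval x = f x})
    (Set.toFinite _).measurableSet
  rw [Set.compl_ofPred] at hcompl
  linarith

section Event

variable {X : Type*} [MeasurableSpace X] {μ : Measure X} {f g : X → Bool} {h : X → ℝ} {ε δ : ℝ}

/-- The points of `X × [0, 1]` on or below the graph of `h`. When `X × [0, 1]` carries the product
of a distribution on `X` and the uniform one, this is an event of conditional probability `h x`
given the first coordinate `x`. -/
def subgraph {X : Type*} (h : X → ℝ) : Set (X × unitInterval) := {p | (p.2 : ℝ) ≤ h p.1}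

theorem measurableSet_subgraph (hh : Measurable h) : MeasurableSet (subgraph h) :=
  measurableSet_le (measurable_subtype_coe.comp measurable_snd) (hh.comp measurable_fst)

theorem IsDensityOfMass.measureReal_subgraph_inter [IsFiniteMeasure μ]
    (hh : IsDensityOfMass μ ε h) {S : Set X} (hS : MeasurableSet S) :
    (μ.prod volume).real (subgraph h ∩ Prod.fst ⁻¹' S) = ∫ x in S, h x ∂μ := by
  have hslice (x : X) : volume (Prod.mk x ⁻¹' (subgraph h ∩ Prod.fst ⁻¹' S)) =
      S.indicator (fun x => ENNReal.ofReal (h x)) x := by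
    by_cases hx : x ∈ S
    · have hIic : Prod.mk x ⁻¹' (subgraph h ∩ Prod.fst ⁻¹' S) =
          Set.Iic (⟨h x, hh.nonneg x, hh.le_one x⟩ : unitInterval) := by
        ext; simp [subgraph, hx, ← Subtype.coe_le_coe]
      rw [hIic, unitInterval.volume_Iic, Set.indicator_of_mem hx]
    · simp [Set.preimage, hx]
  rw [measureReal_def, Measure.prod_apply ((measurableSet_subgraph hh.measurable).inter
    (measurable_fst hS)), lintegral_congr hslice, lintegral_indicator hS,
    integral_eq_lintegral_of_nonneg_ae (.of_forall hh.nonneg) hh.measurable.aestronglyMeasurable]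

theorem IsDensityOfMass.measureReal_subgraph [IsFiniteMeasure μ] (hh : IsDensityOfMass μ ε h) :
    (μ.prod volume).real (subgraph h) = ε := by
  simpa [hh.integral_eq] using hh.measureReal_subgraph_inter .univ

theorem IsDensityOfMass.integral_mul_boolSign_mul_boolSign [IsFiniteMeasure μ]
    (hh : IsDensityOfMass μ ε h) (hf : Measurable f) (hg : Measurable g) :
    ∫ x, h x * (boolSign (f x) * boolSign (g x)) ∂μ = 2 * ∫ x in {x | g x = f x}, h x ∂μ - ε := by
  have hS : MeasurableSet {x | g x = f x} := measurableSet_eq_fun hg hf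
  calc ∫ x, h x * (boolSign (f x) * boolSign (g x)) ∂μ
      = ∫ x, (2 * {x | g x = f x}.indicator h x - h x) ∂μ := by
        refine integral_congr_ae (.of_forall fun x => ?_)
        simp only [boolSign_mul_boolSign, Set.indicator_apply, Set.mem_ofPred_eq]
        split_ifs <;> ring
    _ = 2 * ∫ x in {x | g x = f x}, h x ∂μ - ε := by
        rw [integral_sub ((hh.integrable.indicator hS).const_mul 2) hh.integrable,
          integral_const_mul, integral_indicator hS, hh.integral_eq]

theorem IsDensityOfMass.cond_subgraph_real_eq_le [IsFiniteMeasure μ] (hh : IsDensityOfMass μ ε h)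
    (hε : 0 < ε) (hf : Measurable f) (hg : Measurable g)
    (hcorr : ∫ x, h x * (boolSign (f x) * boolSign (g x)) ∂μ ≤ ε * δ) :
    ((μ.prod volume)[|subgraph h]).real {p | g p.1 = f p.1} ≤ (1 + δ) / 2 := by
  have hinter := hh.measureReal_subgraph_inter (measurableSet_eq_fun hg hf)
  rw [hh.integral_mul_boolSign_mul_boolSign hf hg, ← hinter] at hcorr
  calc ((μ.prod volume)[|subgraph h]).real {p | g p.1 = f p.1}
      = ε⁻¹ * (μ.prod volume).real (subgraph h ∩ Prod.fst ⁻¹' {x | g x = f x}) := by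
        rw [measureReal_def, cond_apply (measurableSet_subgraph hh.measurable), ENNReal.toReal_mul,
          ENNReal.toReal_inv, ← measureReal_def, hh.measureReal_subgraph]
        rfl
    _ ≤ (1 + δ) / 2 := by
        rw [inv_mul_le_iff₀ hε]
        linarith

end Event

theorem mainTheorem2 :
    ∃ c : ℝ, 0 < c ∧
      ∀ (n : ℕ) (V : Measure (Fin n → Bool)) (_ : IsProbabilityMeasure V)
        (f : (Fin n → Bool) → Bool) (s : ℕ) (ε δ : ℝ),
        0 < ε → ε ≤ 1 → 0 < δ → δ < 1 →
        (∀ A : BoolCircuit n, A.size ≤ s → V.real {x | A.eval x = f x} ≤ 1 - ε / 2) →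
        ∃ (Ω : Type) (_ : MeasurableSpace Ω) (P : Measure Ω) (_ : IsProbabilityMeasure P)
          (X : Ω → (Fin n → Bool)) (E : Set Ω),
          Measurable X ∧ P.map X = V ∧ MeasurableSet E ∧ P.real E = ε ∧
          ∀ A : BoolCircuit n, (A.size : ℝ) ≤ c * (s * δ ^ 2 / Real.log (2 / ε)) →
            (P[|E]).real {ω | A.eval (X ω) = f (X ω)} ≤ (1 + δ) / 2 := by
  refine ⟨1 / 120, by norm_num, fun n V _ f s ε δ hε hε1 hδ hδ1 hV => ?_⟩
  obtain ⟨h, hh, hcorr⟩ := BoolCircuit.exists_hardcore_density hε hε1 hδ hδ1.le hV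
  refine ⟨(Fin n → Bool) × unitInterval, inferInstance, V.prod volume, inferInstance, Prod.fst,
    subgraph h, measurable_fst, measurePreserving_fst.map_eq,
    measurableSet_subgraph hh.measurable, hh.measureReal_subgraph, fun A hA => ?_⟩
  exact hh.cond_subgraph_real_eq_le hε (measurable_of_finite f) (measurable_of_finite A.eval)
    (hcorr A hA)
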